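/- All Banach spaces are real. For a Banach space $X$ let $S_X$ be its unit sphere, $\mathcal G_X$ the group of surjective linear isometries $T\colon X\to X$, and for $x\in S_X$, $n\in\mathbb N=\{1,2,\dots\}$ put \[ C_n(x)=\Big\{\sum_{i=1}^n a_iT_i(x)\;:\;T_1,\dots,T_n\in\mathcal G_X,\ a_1,\dots,a_n\in[0,1],\ \sum_{i=1}^n a_i=1\Big\}. \] The space $X$ is called transitive if $\{T(x):T\in\mathcal G_X\}=S_X$ for every $x\in S_X$; almost transitive if $\overline{\{T(x):T\in\mathcal G_X\}}=S_X$ for every $x\in S_X$; and uniformly convex-transitive if for every $\varepsilon>0$ there is $n\in\mathbb N$ such that $\operatorname{dist}(y,C_n(x))\le\varepsilon$ for all $x,y\in S_X$. Let $\mathcal U$ be a non-principal ultrafilter on $\mathbb N$. For a sequence $(E_i)_{i\in\mathbb N}$ of Banach spaces, its ultraproduct is the quotient Banach space \[ \Big(\bigoplus_{i\in\mathbb N}E_i\Big)_{\ell^\infty}\Big/\Big\{(y_i)_{i}\;:\;\lim_{i,\mathcal U}\|y_i\|=0\Big\}. \] Write $X^{\mathcal U}$ for the ultraproduct of the constant sequence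 $E_i=X$, and $\mathcal M(X)$ for the ultraproduct of the Bochner spaces $E_i=L^i([0,1];X)$, $i=1,2,3,\dots$, with respect to Lebesgue measure. Let $L^\infty=L^\infty([0,1];\mathbb R)$. Theorem. Let $X$ be a Banach space. (1) If $X$ is almost transitive, then $\mathcal M(X)$ is transitive. (2) If $X$ is uniformly convex-transitive, then $\mathcal M(X)$ and $X^{\mathcal U}$ are uniformly convex-transitive. (3) In particular, $(L^\infty)^{\mathcal U}$ is uniformly convex-transitive. -/

import Mathlib

open MeasureTheory Filter Topology
open scoped ENNReal

noncomputable section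

section Rotations

variable (X : Type*) [NormedAddCommGroup X] [NormedSpace ℝ X]

/-- The orbit of `x` under the group of isometric (linear, surjective) automorphisms of `X`. -/
def rotationOrbit {X : Type*} [NormedAddCommGroup X] [NormedSpace ℝ X] (x : X) : Set X :=
  {y | ∃ T : X ≃ₗᵢ[ℝ] X, T x = y}

/-- The isometry group acts transitively on the unit sphere. -/
def IsTransitiveSpace : Prop :=
  ∀ x ∈ Metric.sphere (0 : X) 1, rotationOrbit x = Metric.sphere (0 : X) 1

/-- The orbit of every unit vector is dense in the unit sphere. -/
def IsAlmostTransitiveSpace : Prop :=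
  ∀ x ∈ Metric.sphere (0 : X) 1, closure (rotationOrbit x) = Metric.sphere (0 : X) 1

/-- `C_n(x)`: the convex combinations of `n` rotated copies of `x`. -/
def rotationCombinations {X : Type*} [NormedAddCommGroup X] [NormedSpace ℝ X]
    (n : ℕ) (x : X) : Set X :=
  {z | ∃ (T : Fin n → X ≃ₗᵢ[ℝ] X) (a : Fin n → ℝ),
    (∀ i, a i ∈ Set.Icc (0 : ℝ) 1) ∧ ∑ i, a i = 1 ∧ z = ∑ i, a i • T i x}

/-- Uniform convex-transitivity: for every `ε > 0` there is `n ≥ 1` with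
`dist (y, C_n(x)) ≤ ε` for all unit vectors `x`, `y`. For `n ≥ 1` the set `C_n(x)` is non-empty. -/
def IsUniformlyConvexTransitive : Prop :=
  ∀ ε : ℝ, 0 < ε → ∃ n : ℕ, 1 ≤ n ∧
    ∀ x ∈ Metric.sphere (0 : X) 1, ∀ y ∈ Metric.sphere (0 : X) 1,
      Metric.infDist y (rotationCombinations n x) ≤ ε

end Rotations

section Ultraproducts

variable {ι : Type*} (E : ι → Type*) [∀ i, NormedAddCommGroup (E i)] [∀ i, NormedSpace ℝ (E i)]

/-- The subspace of those bounded families whose norms converge to `0` along `U`. -/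
def ultraNull (U : Ultrafilter ι) : Submodule ℝ (lp E ∞) where
  carrier := {y | Tendsto (fun i => ‖y i‖) U (𝓝 0)}
  zero_mem' := by simp
  add_mem' := by
    intro a b ha hb
    have h : Tendsto (fun i => ‖a i‖ + ‖b i‖) U (𝓝 0) := by
      have ha' : Tendsto (fun i => ‖a i‖) U (𝓝 0) := ha
      have hb' : Tendsto (fun i => ‖b i‖) U (𝓝 0) := hb
      simpa only [add_zero] using ha'.add hb'
    exact squeeze_zero (fun i => norm_nonneg _) (fun i => norm_add_le (a i) (b i)) h
  smul_mem' := by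
    intro c a ha
    have h : Tendsto (fun i => ‖c‖ * ‖a i‖) U (𝓝 0) := by
      have ha' : Tendsto (fun i => ‖a i‖) U (𝓝 0) := ha
      simpa only [mul_zero] using ha'.const_mul ‖c‖
    exact squeeze_zero (fun i => norm_nonneg _) (fun i => (norm_smul c (a i)).le) h

instance ultraNull_isClosed (U : Ultrafilter ι) :
    IsClosed (ultraNull E U : Set (lp E ∞)) := by
  refine isClosed_of_closure_subset fun u hu => ?_
  change Tendsto (fun i => ‖u i‖) U (𝓝 0)
  rw [Metric.tendsto_nhds]
  intro ε hε
  obtain ⟨v, hv, huv⟩ := Metric.mem_closure_iff.1 hu (ε / 2) (half_pos hε)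
  have hv' : Tendsto (fun i => ‖v i‖) U (𝓝 0) := hv
  rw [Metric.tendsto_nhds] at hv'
  filter_upwards [hv' (ε / 2) (half_pos hε)] with i hi
  have h1 : ‖u i - v i‖ ≤ ‖u - v‖ := lp.norm_apply_le_norm ENNReal.top_ne_zero (u - v) i
  have h2 : ‖u i‖ ≤ ‖u i - v i‖ + ‖v i‖ := by
    simpa using norm_add_le (u i - v i) (v i)
  rw [dist_eq_norm] at huv
  simp only [dist_zero_right, norm_norm] at hi ⊢
  linarith

/-- The Banach space ultraproduct: the `ℓ^∞`-sum modulo the `U`-null families,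
with the quotient norm. -/
abbrev BanachUltraproduct (U : Ultrafilter ι) : Type _ :=
  lp E ∞ ⧸ ultraNull E U

/-- The Banach space ultrapower `X^U`. -/
abbrev BanachUltrapower (X : Type*) [NormedAddCommGroup X] [NormedSpace ℝ X]
    (U : Ultrafilter ι) : Type _ :=
  BanachUltraproduct (fun _ : ι => X) U

end Ultraproducts

section CabelloSpace

instance fact_one_le_pnat (i : ℕ+) : Fact (1 ≤ ((i : ℕ) : ℝ≥0∞)) :=
  ⟨by exact_mod_cast i.2⟩

/-- The Bochner space `L^p([0,1], m; X)` for Lebesgue measure `m`. -/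
abbrev BochnerUnit (X : Type*) [NormedAddCommGroup X] (p : ℝ≥0∞) : Type _ :=
  Lp X p ((volume : Measure ℝ).restrict (Set.Icc 0 1))

/-- `M(X)`: the ultraproduct of the Bochner spaces `L^i(X)`, `i = 1, 2, 3, …`. -/
abbrev CabelloM (X : Type*) [NormedAddCommGroup X] [NormedSpace ℝ X]
    (U : Ultrafilter ℕ+) : Type _ :=
  BanachUltraproduct (fun i : ℕ+ => BochnerUnit X ((i : ℕ) : ℝ≥0∞)) U

end CabelloSpace

end

/-! ### Uniform averages of rotations -/

section Averages

variable {E : Type*} [NormedAddCommGroup E] [NormedSpace ℝ E]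

/-! Both transitivity hypotheses become one statement, `RotationAverageApprox`: approximation by
averages with equal weights over a fixed finite index set. Almost transitivity is the one-term case.
For uniform convex-transitivity, the coefficients of a convex combination are rounded to multiples
of `1 / N`, with `N` independent of the vectors.

This form passes to ultraproducts: all coordinates use the same index set and weights, so
coordinatewise rotations assemble into rotations of the ultraproduct, with the coordinate errors
controlled along `U` (`exists_ultraproductRotation_average`). Errors tending to `0` with a one-point
index set give exact transitivity.

It also passes from `E` to `L^p(E)`, `p < ∞`, with the same index set and arbitrarily small extra
error (`RotationAverageApprox.lp`). If `f` is a nowhere vanishing unit vector, `‖f‖ ^ p` is the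
density of an atomless probability measure, which is isomorphic to Lebesgue measure; the
corresponding weighted composition operator turns `f` into a function with values of norm one. Two
such functions nearly constant on the pieces of a countable partition are matched by applying
rotations of `E` piece by piece. Nothing depends on `p`, so `M(X)` follows.

For real `L^∞` (`rotationAverageApprox_Linfty`), a rotation is composition with a null-preserving
automorphism followed by multiplication by signs. Averaging over automorphisms that carry most of
the interval into the set where `|f|` is almost `1` brings `|f|` near the constant `1`; averaging
over signs then produces any target. -/

/-- Every unit vector is approximated up to `ε` by a uniform average, indexed by `κ`, of rotations
of any other unit vector. -/
def RotationAverageApprox (E : Type*) [NormedAddCommGroup E] [NormedSpace ℝ E]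
    (κ : Type*) [Fintype κ] (ε : ℝ) : Prop :=
  ∀ x y : E, ‖x‖ = 1 → ‖y‖ = 1 →
    ∃ T : κ → E ≃ₗᵢ[ℝ] E, ‖y - (Fintype.card κ : ℝ)⁻¹ • ∑ k, T k x‖ ≤ ε

theorem RotationAverageApprox.congr {κ κ' : Type*} [Fintype κ] [Fintype κ'] (e : κ' ≃ κ) {ε : ℝ}
    (h : RotationAverageApprox E κ ε) : RotationAverageApprox E κ' ε := by
  intro x y hx hy
  obtain ⟨T, hT⟩ := h x y hx hy
  refine ⟨fun k => T (e k), ?_⟩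
  rw [Fintype.card_congr e, Equiv.sum_comp e (fun k => T k x)]
  exact hT

theorem norm_average_le {κ : Type*} [Fintype κ] [Nonempty κ] (f : κ → E) {c : ℝ}
    (hf : ∀ k, ‖f k‖ ≤ c) : ‖(Fintype.card κ : ℝ)⁻¹ • ∑ k, f k‖ ≤ c := by
  have hN : (0 : ℝ) < Fintype.card κ := by exact_mod_cast Fintype.card_pos
  have h1 : ‖∑ k, f k‖ ≤ Fintype.card κ * c := by
    refine (norm_sum_le _ _).trans ((Finset.sum_le_sum fun k _ => hf k).trans ?_)
    simp
  rw [norm_smul, norm_inv, Real.norm_of_nonneg hN.le, inv_mul_le_iff₀ hN]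
  exact h1

theorem IsAlmostTransitiveSpace.rotationAverageApprox (h : IsAlmostTransitiveSpace E) {ε : ℝ}
    (hε : 0 < ε) : RotationAverageApprox E (Fin 1) ε := by
  intro x y hx hy
  have hy' : y ∈ closure (rotationOrbit x) := by
    rw [h x (by simpa using hx)]
    simpa using hy
  obtain ⟨z, ⟨T, rfl⟩, hz⟩ := Metric.mem_closure_iff.1 hy' ε hε
  refine ⟨fun _ => T, ?_⟩
  simpa [dist_eq_norm] using hz.le

theorem isUniformlyConvexTransitive_of_rotationAverageApprox
    (h : ∀ ε : ℝ, 0 < ε → ∃ n : ℕ, 1 ≤ n ∧ RotationAverageApprox E (Fin n) ε) :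
    IsUniformlyConvexTransitive E := by
  intro ε hε
  obtain ⟨n, hn, H⟩ := h ε hε
  refine ⟨n, hn, fun x hx y hy => ?_⟩
  obtain ⟨T, hT⟩ := H x y (by simpa using hx) (by simpa using hy)
  have hn' : (1 : ℝ) ≤ n := by exact_mod_cast hn
  refine (Metric.infDist_le_dist_of_mem ?_).trans ((dist_eq_norm y _).le.trans hT)
  refine ⟨T, fun _ => (n : ℝ)⁻¹, fun i => ⟨by positivity, inv_le_one_of_one_le₀ hn'⟩, ?_, ?_⟩
  · simp [show (n : ℝ) ≠ 0 by positivity]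
  · simp [Finset.smul_sum]

/-- A convex combination of rotations is close to a uniform average of rotations, with a number
of terms that does not depend on the coefficients. -/
theorem exists_average_approx {n N : ℕ} (hN : 0 < N) (T : Fin n → E ≃ₗᵢ[ℝ] E) (a : Fin n → ℝ)
    (ha : ∀ i, 0 ≤ a i) (ha1 : ∑ i, a i = 1) {x : E} (hx : ‖x‖ = 1) :
    ∃ S : Fin N → E ≃ₗᵢ[ℝ] E,
      ‖∑ i, a i • T i x - (N : ℝ)⁻¹ • ∑ k, S k x‖ ≤ 2 * n / N := by
  have hN' : (0 : ℝ) < N := by exact_mod_cast hN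
  -- Repeat each rotation `⌊N * a i⌋₊` times and fill the remaining `r ≤ n` slots with the identity.
  -- Rounding and filling each cost at most `n / N`.
  set m : Fin n → ℕ := fun i => ⌊N * a i⌋₊ with hm
  have hm1 : ∀ i, (m i : ℝ) ≤ N * a i := fun i => Nat.floor_le (by have := ha i; positivity)
  have hm2 : ∀ i, N * a i ≤ m i + 1 := fun i => (Nat.lt_floor_add_one _).le
  have hsum : ∑ i, (m i : ℝ) ≤ N := by
    refine (Finset.sum_le_sum fun i _ => hm1 i).trans ?_
    rw [← Finset.mul_sum, ha1, mul_one]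
  have hsum2 : (N : ℝ) ≤ ∑ i, (m i : ℝ) + n := by
    have := Finset.sum_le_sum fun i (_ : i ∈ Finset.univ) => hm2 i
    rw [← Finset.mul_sum, ha1, mul_one, Finset.sum_add_distrib] at this
    simpa using this
  have hle : ∑ i, m i ≤ N := by exact_mod_cast hsum
  obtain ⟨r, hr⟩ := Nat.exists_eq_add_of_le hle
  have hr' : (N : ℝ) = ∑ i, (m i : ℝ) + r := by exact_mod_cast hr
  have hcard : Fintype.card ((Σ i, Fin (m i)) ⊕ Fin r) = N := by simp [hr]
  let e := (Fintype.equivFinOfCardEq hcard).symm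
  let S' : (Σ i, Fin (m i)) ⊕ Fin r → E ≃ₗᵢ[ℝ] E :=
    Sum.elim (fun p => T p.1) (fun _ => LinearIsometryEquiv.refl ℝ E)
  refine ⟨fun k => S' (e k), ?_⟩
  have hS : ∑ k, S' (e k) x = ∑ i, (m i : ℝ) • T i x + (r : ℝ) • x := by
    rw [Equiv.sum_comp e (fun k => S' k x), Fintype.sum_sum_type, Fintype.sum_sigma]
    simp [S', ← Nat.cast_smul_eq_nsmul ℝ]
  have h1 : ∑ i, a i • T i x - (N : ℝ)⁻¹ • ∑ k, S' (e k) x =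
      (N : ℝ)⁻¹ • (∑ i, (N * a i - m i) • T i x - (r : ℝ) • x) := by
    rw [hS]
    simp only [sub_smul, Finset.sum_sub_distrib, mul_smul, ← Finset.smul_sum]
    rw [smul_sub, smul_sub, smul_add, inv_smul_smul₀ hN'.ne']
    abel
  have h2 : ‖∑ i, (N * a i - m i) • T i x - (r : ℝ) • x‖ ≤ 2 * n := by
    refine (norm_sub_le _ _).trans ?_
    have h3 : ‖∑ i, (N * a i - m i) • T i x‖ ≤ n := by
      refine (norm_sum_le _ _).trans ?_
      calc ∑ i, ‖(N * a i - m i) • T i x‖ ≤ ∑ i : Fin n, (1 : ℝ) := by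
            refine Finset.sum_le_sum fun i _ => ?_
            rw [norm_smul, LinearIsometryEquiv.norm_map, hx, mul_one, Real.norm_eq_abs, abs_le]
            constructor <;> linarith [hm1 i, hm2 i]
        _ = n := by simp
    have h4 : ‖(r : ℝ) • x‖ ≤ n := by
      rw [norm_smul, hx, mul_one, Real.norm_of_nonneg (Nat.cast_nonneg r)]
      linarith
    linarith
  rw [h1, norm_smul, norm_inv, Real.norm_of_nonneg hN'.le, inv_mul_le_iff₀ hN',
    mul_div_cancel₀ _ hN'.ne']
  exact h2

/-- The rounding error `2 * n / N` is uniform in the coefficients, so one `N` serves all pairs of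
unit vectors. -/
theorem IsUniformlyConvexTransitive.rotationAverageApprox (h : IsUniformlyConvexTransitive E)
    {ε : ℝ} (hε : 0 < ε) : ∃ n : ℕ, 1 ≤ n ∧ RotationAverageApprox E (Fin n) ε := by
  obtain ⟨n, hn, H⟩ := h (ε / 4) (by positivity)
  obtain ⟨N, hN⟩ := exists_nat_gt (2 * n / (ε / 2))
  have hN' : (0 : ℝ) < N := lt_of_le_of_lt (by positivity) hN
  have hN0 : 0 < N := by exact_mod_cast hN'
  refine ⟨N, hN0, fun x y hx hy => ?_⟩
  have hd := H x (by simpa using hx) y (by simpa using hy)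
  have hne : (rotationCombinations n x).Nonempty := by
    have hn' : (1 : ℝ) ≤ n := by exact_mod_cast hn
    refine ⟨_, fun _ => LinearIsometryEquiv.refl ℝ E, fun _ => (n : ℝ)⁻¹,
      fun i => ⟨by positivity, inv_le_one_of_one_le₀ hn'⟩, ?_, rfl⟩
    simp [show (n : ℝ) ≠ 0 by positivity]
  obtain ⟨z, ⟨T, a, ha, ha1, rfl⟩, hz⟩ :=
    (Metric.infDist_lt_iff hne).1 (lt_of_le_of_lt hd (show ε / 4 < ε / 2 by linarith))
  obtain ⟨S, hS⟩ := exists_average_approx hN0 T a (fun i => (ha i).1) ha1 hx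
  refine ⟨S, ?_⟩
  rw [dist_eq_norm] at hz
  have h2 : 2 * n / N ≤ ε / 2 := by
    rw [div_lt_iff₀ (by positivity)] at hN
    rw [div_le_iff₀ hN']
    linarith
  rw [Fintype.card_fin]
  have := norm_sub_le_norm_sub_add_norm_sub y (∑ i, a i • T i x) ((N : ℝ)⁻¹ • ∑ k, S k x)
  linarith

end Averages

/-! ### Rotations of ultraproducts -/

section UltraproductRotations

variable {ι : Type*} {E : ι → Type*} [∀ i, NormedAddCommGroup (E i)] [∀ i, NormedSpace ℝ (E i)]
variable {U : Ultrafilter ι}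

/-- Replacing the coordinates outside a `U`-large set by zero does not change the class, and bounds
the sup norm of the representative. -/
theorem norm_mk_le_of_eventually_le (x : lp E ∞) {c : ℝ} (hc : 0 ≤ c)
    (h : ∀ᶠ i in U, ‖x i‖ ≤ c) :
    ‖(Submodule.Quotient.mk x : BanachUltraproduct E U)‖ ≤ c := by
  classical
  let z : ∀ i, E i := fun i => if ‖x i‖ ≤ c then x i else 0
  have hzc : ∀ i, ‖z i‖ ≤ c := by
    intro i
    by_cases hi : ‖x i‖ ≤ c
    · simp [z, hi]
    · simp [z, hi, hc]
  have hz : Memℓp z ∞ := memℓp_infty ⟨c, by rintro _ ⟨i, rfl⟩; exact hzc i⟩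
  let z' : lp E ∞ := ⟨z, hz⟩
  have hmk : (Submodule.Quotient.mk x : BanachUltraproduct E U) = Submodule.Quotient.mk z' := by
    rw [Submodule.Quotient.eq]
    change Tendsto (fun i => ‖(x - z') i‖) U (𝓝 0)
    refine tendsto_const_nhds.congr' ?_
    filter_upwards [h] with i hi
    have : z' i = x i := by simp [z', z, hi]
    simp [this]
  rw [hmk]
  exact (Submodule.Quotient.norm_mk_le _ _).trans (lp.norm_le_of_forall_le hc hzc)

/-- A representative of nearly minimal norm differs from `x` by a `U`-null family, so some
coordinate of it has norm almost `c`. -/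
theorem le_norm_mk_of_eventually_le (x : lp E ∞) {c : ℝ} (h : ∀ᶠ i in U, c ≤ ‖x i‖) :
    c ≤ ‖(Submodule.Quotient.mk x : BanachUltraproduct E U)‖ := by
  refine le_of_forall_pos_lt_add fun ε hε => ?_
  obtain ⟨z, hz, hzn⟩ := Submodule.Quotient.norm_mk_lt
    (S := ultraNull E U) (Submodule.Quotient.mk x) (half_pos hε)
  have hnull : Tendsto (fun i => ‖(z - x) i‖) U (𝓝 0) := (Submodule.Quotient.eq _).1 hz
  obtain ⟨i, hi, hi'⟩ := (h.and (hnull.eventually (gt_mem_nhds (half_pos hε)))).exists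
  have h1 : ‖z i‖ ≤ ‖z‖ := lp.norm_apply_le_norm ENNReal.top_ne_zero z i
  have h2 : ‖x i‖ ≤ ‖z i‖ + ‖z i - x i‖ := by
    rw [norm_sub_rev]
    simpa using norm_add_le (z i) (x i - z i)
  have h3 : ‖z i - x i‖ < ε / 2 := hi'
  linarith

/-- The ultraproduct norm is the limit of the norms along the ultrafilter. -/
theorem tendsto_norm_mk (x : lp E ∞) :
    Tendsto (fun i => ‖x i‖) U
      (𝓝 ‖(Submodule.Quotient.mk x : BanachUltraproduct E U)‖) := by
  refine tendsto_order.2 ⟨fun c hc => ?_, fun c hc => ?_⟩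
  · by_contra hcon
    rw [← Ultrafilter.eventually_not] at hcon
    rcases le_or_gt 0 c with h0 | h0
    · exact absurd (norm_mk_le_of_eventually_le x h0 (hcon.mono fun i hi => not_lt.1 hi))
        (not_le.2 hc)
    · obtain ⟨i, hi⟩ := hcon.exists
      exact hi (h0.trans_le (norm_nonneg _))
  · by_contra hcon
    rw [← Ultrafilter.eventually_not] at hcon
    exact absurd (le_norm_mk_of_eventually_le x (hcon.mono fun i hi => not_lt.1 hi)) (not_le.2 hc)

/-- A family of surjective isometries acts on the `ℓ^∞`-sum. -/
noncomputable def lpRotation (T : ∀ i, E i ≃ₗᵢ[ℝ] E i) : lp E ∞ ≃ₗ[ℝ] lp E ∞ where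
  toFun x := ⟨fun i => T i (x i), memℓp_infty ⟨‖x‖, by
    rintro _ ⟨i, rfl⟩
    simpa using lp.norm_apply_le_norm ENNReal.top_ne_zero x i⟩⟩
  invFun x := ⟨fun i => (T i).symm (x i), memℓp_infty ⟨‖x‖, by
    rintro _ ⟨i, rfl⟩
    simpa using lp.norm_apply_le_norm ENNReal.top_ne_zero x i⟩⟩
  map_add' x y := by ext i; exact map_add (T i) _ _
  map_smul' c x := by ext i; simp
  left_inv x := by ext i; simp
  right_inv x := by ext i; simp

@[simp] theorem lpRotation_apply (T : ∀ i, E i ≃ₗᵢ[ℝ] E i) (x : lp E ∞) (i : ι) :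
    lpRotation T x i = T i (x i) := rfl

theorem map_ultraNull_lpRotation (T : ∀ i, E i ≃ₗᵢ[ℝ] E i) :
    (ultraNull E U).map (lpRotation T : lp E ∞ →ₗ[ℝ] lp E ∞) = ultraNull E U := by
  ext x
  simp only [Submodule.mem_map_equiv]
  change Tendsto (fun i => ‖(T i).symm (x i)‖) U (𝓝 0) ↔ Tendsto (fun i => ‖x i‖) U (𝓝 0)
  simp

/-- A family of surjective isometries acts on the ultraproduct. -/
noncomputable def ultraproductRotation (U : Ultrafilter ι) (T : ∀ i, E i ≃ₗᵢ[ℝ] E i) :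
    BanachUltraproduct E U ≃ₗᵢ[ℝ] BanachUltraproduct E U where
  toLinearEquiv := Submodule.Quotient.equiv _ _ (lpRotation T) (map_ultraNull_lpRotation T)
  norm_map' x := by
    obtain ⟨x, rfl⟩ := Submodule.Quotient.mk_surjective _ x
    refine tendsto_nhds_unique (tendsto_norm_mk (U := U) (lpRotation T x)) ?_
    simpa using tendsto_norm_mk (U := U) x

theorem ultraproductRotation_mk (T : ∀ i, E i ≃ₗᵢ[ℝ] E i) (x : lp E ∞) :
    ultraproductRotation U T (Submodule.Quotient.mk x) = Submodule.Quotient.mk (lpRotation T x) :=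
  rfl

/-- Coordinatewise approximations of unit vectors give approximations in the ultraproduct, with
an error that is controlled along the ultrafilter. -/
theorem exists_ultraproductRotation_average {κ : Type*} [Fintype κ] {ε : ι → ℝ}
    (h : ∀ i, RotationAverageApprox (E i) κ (ε i)) [Nonempty κ]
    {x y : BanachUltraproduct E U} (hx : ‖x‖ = 1) (hy : ‖y‖ = 1) :
    ∃ T : κ → BanachUltraproduct E U ≃ₗᵢ[ℝ] BanachUltraproduct E U,
      ∀ c : ℝ, 0 ≤ c → (∀ δ : ℝ, 0 < δ → ∀ᶠ i in U, ε i ≤ c + δ) →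
        ‖y - (Fintype.card κ : ℝ)⁻¹ • ∑ k, T k x‖ ≤ c := by
  classical
  obtain ⟨x, rfl⟩ := Submodule.Quotient.mk_surjective _ x
  obtain ⟨y, rfl⟩ := Submodule.Quotient.mk_surjective _ y
  -- Individual coordinates need not be unit vectors: normalise them, and use the identity wherever
  -- one of them vanishes.
  have key : ∀ i, ∃ T : κ → E i ≃ₗᵢ[ℝ] E i, x i ≠ 0 → y i ≠ 0 →
      ‖‖y i‖⁻¹ • y i - (Fintype.card κ : ℝ)⁻¹ • ∑ k, T k (‖x i‖⁻¹ • x i)‖ ≤ ε i := by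
    intro i
    by_cases h0 : x i ≠ 0 ∧ y i ≠ 0
    · obtain ⟨T, hT⟩ := h i (‖x i‖⁻¹ • x i) (‖y i‖⁻¹ • y i)
        (by rw [norm_smul, norm_inv, norm_norm, inv_mul_cancel₀ (norm_ne_zero_iff.2 h0.1)])
        (by rw [norm_smul, norm_inv, norm_norm, inv_mul_cancel₀ (norm_ne_zero_iff.2 h0.2)])
      exact ⟨T, fun _ _ => hT⟩
    · exact ⟨fun _ => LinearIsometryEquiv.refl ℝ _, fun h1 h2 => absurd ⟨h1, h2⟩ h0⟩
  choose T hT using key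
  refine ⟨fun k => ultraproductRotation U fun i => T i k, fun c hc hcε => ?_⟩
  have hxl := tendsto_norm_mk (U := U) x
  have hyl := tendsto_norm_mk (U := U) y
  rw [hx] at hxl
  rw [hy] at hyl
  have hmk : (Submodule.Quotient.mk y : BanachUltraproduct E U) - (Fintype.card κ : ℝ)⁻¹ •
      ∑ k, ultraproductRotation U (fun i => T i k) (Submodule.Quotient.mk x) =
      Submodule.Quotient.mk
        (y - (Fintype.card κ : ℝ)⁻¹ • ∑ k, lpRotation (fun i => T i k) x) := by
    simp only [ultraproductRotation_mk]
    simp only [← Submodule.mkQ_apply, map_sub, map_smul, map_sum]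
  rw [hmk]
  refine le_of_forall_pos_le_add fun δ hδ => ?_
  refine norm_mk_le_of_eventually_le _ (by positivity) ?_
  -- The bound `1` keeps both coordinates nonzero; the two normalisation errors `δ / 4` and the
  -- slack `δ / 2` in `ε i` add up to `δ`.
  filter_upwards [hcε (δ / 2) (half_pos hδ),
    hxl.eventually (Metric.ball_mem_nhds (1 : ℝ) (show 0 < min 1 (δ / 4) by positivity)),
    hyl.eventually (Metric.ball_mem_nhds (1 : ℝ) (show 0 < min 1 (δ / 4) by positivity))]
    with i hi hxi hyi
  have hdev : ∀ v : E i, v ≠ 0 → ‖v - ‖v‖⁻¹ • v‖ = |‖v‖ - 1| := by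
    intro v hv
    have hv' := norm_ne_zero_iff.2 hv
    have : v - ‖v‖⁻¹ • v = (1 - ‖v‖⁻¹) • v := by rw [sub_smul, one_smul]
    rw [this, norm_smul, Real.norm_eq_abs, ← abs_norm v, ← abs_mul, abs_norm, sub_mul, one_mul,
      inv_mul_cancel₀ hv']
  rw [Real.dist_eq, abs_lt] at hxi hyi
  have m1 := min_le_left 1 (δ / 4)
  have m2 := min_le_right 1 (δ / 4)
  have hx0 : x i ≠ 0 := norm_pos_iff.1 (by linarith)
  have hy0 : y i ≠ 0 := norm_pos_iff.1 (by linarith)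
  have hxd : |‖x i‖ - 1| ≤ δ / 4 := by rw [abs_le]; constructor <;> linarith
  have hyd : |‖y i‖ - 1| ≤ δ / 4 := by rw [abs_le]; constructor <;> linarith
  rw [← hdev _ hx0] at hxd
  rw [← hdev _ hy0] at hyd
  have hav : ‖(Fintype.card κ : ℝ)⁻¹ • ∑ k, T i k (x i - ‖x i‖⁻¹ • x i)‖ ≤ δ / 4 :=
    norm_average_le _ fun k => by rw [LinearIsometryEquiv.norm_map]; exact hxd
  have hi' := hT i hx0 hy0
  have hco : (y - (Fintype.card κ : ℝ)⁻¹ • ∑ k, lpRotation (fun i => T i k) x : lp E ∞) i =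
      (y i - ‖y i‖⁻¹ • y i) +
      (‖y i‖⁻¹ • y i - (Fintype.card κ : ℝ)⁻¹ • ∑ k, T i k (‖x i‖⁻¹ • x i)) -
      (Fintype.card κ : ℝ)⁻¹ • ∑ k, T i k (x i - ‖x i‖⁻¹ • x i) := by
    simp only [lp.coeFn_sub, lp.coeFn_smul, lp.coeFn_sum, Pi.sub_apply, Pi.smul_apply,
      Finset.sum_apply, lpRotation_apply, map_sub, Finset.sum_sub_distrib, smul_sub]
    abel
  rw [hco]
  refine (norm_sub_le _ _).trans ?_
  have := norm_add_le (y i - ‖y i‖⁻¹ • y i)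
    (‖y i‖⁻¹ • y i - (Fintype.card κ : ℝ)⁻¹ • ∑ k, T i k (‖x i‖⁻¹ • x i))
  linarith

theorem isUniformlyConvexTransitive_ultraproduct
    (h : ∀ ε : ℝ, 0 < ε → ∃ n : ℕ, 1 ≤ n ∧ ∀ i, RotationAverageApprox (E i) (Fin n) ε) :
    IsUniformlyConvexTransitive (BanachUltraproduct E U) := by
  refine isUniformlyConvexTransitive_of_rotationAverageApprox fun ε hε => ?_
  obtain ⟨n, hn, H⟩ := h ε hε
  have : Nonempty (Fin n) := ⟨⟨0, hn⟩⟩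
  refine ⟨n, hn, fun x y hx hy => ?_⟩
  obtain ⟨T, hT⟩ := exists_ultraproductRotation_average H hx hy
  exact ⟨T, hT ε hε.le fun δ hδ => Eventually.of_forall fun i => by linarith⟩

/-- The single rotation is built before any error bound is chosen, so its error is at most the limit
`0`: the approximation becomes an equality. -/
theorem isTransitiveSpace_ultraproduct {ε : ι → ℝ} (hε : Tendsto ε U (𝓝 0))
    (h : ∀ i, RotationAverageApprox (E i) (Fin 1) (ε i)) :
    IsTransitiveSpace (BanachUltraproduct E U) := by
  intro x hx
  ext y
  constructor
  · rintro ⟨T, rfl⟩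
    simpa using hx
  · intro hy
    obtain ⟨T, hT⟩ := exists_ultraproductRotation_average h (x := x) (y := y)
      (by simpa using hx) (by simpa using hy)
    have h0 := hT 0 le_rfl fun δ hδ => by
      rw [zero_add]
      exact (hε.eventually (gt_mem_nhds hδ)).mono fun i hi => le_of_lt hi
    refine ⟨T 0, ?_⟩
    have h1 : y - T 0 x = 0 := by simpa using h0
    exact (sub_eq_zero.1 h1).symm

end UltraproductRotations

/-! ### Quantile functions and isomorphism of atomless measures -/

section Quantile

open ProbabilityTheory

/-- Lebesgue measure on the unit interval. -/
noncomputable abbrev unitLebesgue : Measure ℝ := (volume : Measure ℝ).restrict (Set.Icc 0 1)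

instance isProbabilityMeasure_unitLebesgue : IsProbabilityMeasure unitLebesgue :=
  ⟨by simp⟩

/-- The quantile function of a probability measure on the line. -/
noncomputable def quantile (μ : Measure ℝ) (u : ℝ) : ℝ := sInf {x | u ≤ cdf μ x}

variable {μ : Measure ℝ}

/-- Right continuity of the cdf makes the infimum attained. For `u` strictly between `0` and `1` the
set is nonempty and bounded below, so `sInf` takes no default value. -/
theorem quantile_le_iff {u : ℝ} (hu : u ∈ Set.Ioo (0 : ℝ) 1) (x : ℝ) :
    quantile μ u ≤ x ↔ u ≤ cdf μ x := by
  have hbdd : BddBelow {x | u ≤ cdf μ x} := by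
    obtain ⟨b, hb⟩ := ((tendsto_cdf_atBot μ).eventually (gt_mem_nhds hu.1)).exists
    refine ⟨b, fun y hy => le_of_not_gt fun hyb => ?_⟩
    exact absurd (lt_of_le_of_lt (le_trans hy (monotone_cdf μ hyb.le)) hb) (lt_irrefl u)
  have hne : {x | u ≤ cdf μ x}.Nonempty := by
    obtain ⟨b, hb⟩ := ((tendsto_cdf_atTop μ).eventually (lt_mem_nhds hu.2)).exists
    exact ⟨b, hb.le⟩
  refine ⟨fun h => ?_, fun h => csInf_le hbdd h⟩
  have hgt : ∀ y, quantile μ u < y → u ≤ cdf μ y := by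
    intro y hy
    obtain ⟨z, hz, hzy⟩ := (csInf_lt_iff hbdd hne).1 hy
    exact le_trans hz (monotone_cdf μ hzy.le)
  have hr : Tendsto (cdf μ) (𝓝[>] x) (𝓝 (cdf μ x)) :=
    ((cdf μ).right_continuous x).mono_left (nhdsWithin_mono _ Set.Ioi_subset_Ici_self)
  refine ge_of_tendsto hr ?_
  filter_upwards [self_mem_nhdsWithin] with y hy
  exact hgt y (lt_of_le_of_lt h hy)

theorem ae_mem_Ioo_unitLebesgue : ∀ᵐ u ∂unitLebesgue, u ∈ Set.Ioo (0 : ℝ) 1 := by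
  rw [unitLebesgue, ← Measure.restrict_congr_set Ioo_ae_eq_Icc]
  exact ae_restrict_mem measurableSet_Ioo

theorem aemeasurable_quantile : AEMeasurable (quantile μ) unitLebesgue := by
  rw [unitLebesgue, ← Measure.restrict_congr_set Ioo_ae_eq_Icc]
  refine aemeasurable_restrict_of_monotoneOn measurableSet_Ioo fun u hu v hv huv => ?_
  rw [quantile_le_iff hu]
  exact huv.trans ((quantile_le_iff hv _).1 le_rfl)

theorem map_quantile [IsProbabilityMeasure μ] : unitLebesgue.map (quantile μ) = μ := by
  have : IsProbabilityMeasure (unitLebesgue.map (quantile μ)) :=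
    Measure.isProbabilityMeasure_map aemeasurable_quantile
  refine Measure.ext_of_Iic _ _ fun x => ?_
  rw [Measure.map_apply_of_aemeasurable aemeasurable_quantile measurableSet_Iic]
  have h1 : (quantile μ ⁻¹' Set.Iic x : Set ℝ) =ᵐ[unitLebesgue] Set.Iic (cdf μ x) := by
    filter_upwards [ae_mem_Ioo_unitLebesgue] with u hu
    exact propext (quantile_le_iff hu x)
  rw [measure_congr h1, Measure.restrict_apply measurableSet_Iic, ← ofReal_cdf]
  have h2 : Set.Iic (cdf μ x) ∩ Set.Icc 0 1 = Set.Icc 0 (cdf μ x) := by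
    ext u
    simp only [Set.mem_inter_iff, Set.mem_Iic, Set.mem_Icc]
    exact ⟨fun h => ⟨h.2.1, h.1⟩, fun h => ⟨h.2, h.1, h.2.trans (cdf_le_one μ x)⟩⟩
  rw [h2, Real.volume_Icc, sub_zero]

/-- Without atoms the cdf agrees with its left limit at the quantile, and to the left of the
quantile the cdf stays below `u`. -/
theorem cdf_quantile [IsProbabilityMeasure μ] [NullSingletonClass μ] :
    ∀ᵐ u ∂unitLebesgue, cdf μ (quantile μ u) = u := by
  filter_upwards [ae_mem_Ioo_unitLebesgue] with u hu
  refine le_antisymm ?_ ((quantile_le_iff hu _).1 le_rfl)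
  have hl : Function.leftLim (cdf μ) (quantile μ u) = cdf μ (quantile μ u) := by
    have h0 := (cdf μ).measure_singleton (quantile μ u)
    rw [measure_cdf, measure_singleton, eq_comm, ENNReal.ofReal_eq_zero] at h0
    exact le_antisymm ((monotone_cdf μ).leftLim_le le_rfl) (by linarith)
  rw [← hl]
  refine le_of_tendsto ((monotone_cdf μ).tendsto_leftLim _) ?_
  filter_upwards [self_mem_nhdsWithin] with y hy
  exact le_of_not_ge fun h => absurd ((quantile_le_iff hu y).2 h) (not_le.2 hy)

/-- Two measurable maps that are inverse to each other almost everywhere and preserve null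
sets. -/
structure IsAEInverse (μ ν : Measure ℝ) (φ ψ : ℝ → ℝ) : Prop where
  qmp : Measure.QuasiMeasurePreserving φ ν μ
  qmp_inv : Measure.QuasiMeasurePreserving ψ μ ν
  left : ∀ᵐ t ∂μ, φ (ψ t) = t
  right : ∀ᵐ u ∂ν, ψ (φ u) = u

theorem IsAEInverse.symm {μ ν : Measure ℝ} {φ ψ : ℝ → ℝ} (h : IsAEInverse μ ν φ ψ) :
    IsAEInverse ν μ ψ φ := ⟨h.qmp_inv, h.qmp, h.right, h.left⟩

theorem IsAEInverse.comp {μ ν κ : Measure ℝ} {φ ψ φ' ψ' : ℝ → ℝ} (h : IsAEInverse μ ν φ ψ)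
    (h' : IsAEInverse ν κ φ' ψ') : IsAEInverse μ κ (φ ∘ φ') (ψ' ∘ ψ) where
  qmp := h.qmp.comp h'.qmp
  qmp_inv := h'.qmp_inv.comp h.qmp_inv
  left := by
    filter_upwards [h.left, h.qmp_inv.ae h'.left] with t ht ht'
    simp only [Function.comp_apply, ht', ht]
  right := by
    filter_upwards [h'.right, h'.qmp.ae h.right] with t ht ht'
    simp only [Function.comp_apply, ht', ht]

/-- An a.e. left inverse of a measure preserving map is an a.e. inverse. -/
theorem isAEInverse_of_left_inverse {μ ν : Measure ℝ} {φ ψ : ℝ → ℝ} (hφ : Measurable φ)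
    (hψ : Measurable ψ) (hmap : ν.map φ = μ) (h : ∀ᵐ u ∂ν, ψ (φ u) = u) :
    IsAEInverse μ ν φ ψ where
  qmp := ⟨hφ, hmap.le.absolutelyContinuous⟩
  qmp_inv := by
    refine ⟨hψ, ?_⟩
    have h' : ψ ∘ φ =ᵐ[ν] id := h
    rw [← hmap, Measure.map_map hψ hφ, Measure.map_congr h', Measure.map_id]
  left := by
    have hm : MeasurableSet {t | φ (ψ t) = t} :=
      measurableSet_eq_fun (hφ.comp hψ) measurable_id
    rw [← hmap, ae_map_iff hφ.aemeasurable hm]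
    filter_upwards [h] with u hu
    rw [hu]
  right := h

/-- Every atomless probability measure on the line is isomorphic to Lebesgue measure. -/
theorem exists_measure_isomorphism (μ : Measure ℝ) [IsProbabilityMeasure μ] [NullSingletonClass μ] :
    ∃ φ ψ : ℝ → ℝ, unitLebesgue.map φ = μ ∧ IsAEInverse μ unitLebesgue φ ψ ∧
      ∀ᵐ u ∂unitLebesgue, ∀ x, φ u ≤ x ↔ u ≤ cdf μ x := by
  have hq := aemeasurable_quantile (μ := μ)
  -- The quantile function is only a.e. measurable here; a measurable representative is used, with
  -- the cdf as its a.e. inverse.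
  have hmap : unitLebesgue.map (hq.mk _) = μ := by
    rw [← Measure.map_congr hq.ae_eq_mk, map_quantile]
  refine ⟨hq.mk _, cdf μ, hmap, isAEInverse_of_left_inverse hq.measurable_mk
    (monotone_cdf μ).measurable hmap ?_, ?_⟩
  · filter_upwards [cdf_quantile (μ := μ), hq.ae_eq_mk] with u hu hu'
    rw [← hu', hu]
  · filter_upwards [ae_mem_Ioo_unitLebesgue, hq.ae_eq_mk] with u hu hu'
    rw [← hu']
    exact quantile_le_iff hu

end Quantile

/-! ### Isometries of Bochner spaces -/

section LpIsometries

variable {E : Type*} [NormedAddCommGroup E] [NormedSpace ℝ E]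
variable {μ ν : Measure ℝ} {p : ℝ≥0∞}

/-- A linear isomorphism between Bochner spaces that is given by an operation on functions. -/
theorem exists_lp_isometry [Fact (1 ≤ p)] (Φ Ψ : (ℝ → E) → ℝ → E)
    (hΦ : ∀ f, AEStronglyMeasurable f μ → AEStronglyMeasurable (Φ f) ν)
    (hΨ : ∀ f, AEStronglyMeasurable f ν → AEStronglyMeasurable (Ψ f) μ)
    (hcongr : ∀ f g, f =ᵐ[μ] g → Φ f =ᵐ[ν] Φ g)
    (hadd : ∀ f g, Φ (f + g) = Φ f + Φ g) (hsmul : ∀ (c : ℝ) f, Φ (c • f) = c • Φ f)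
    (hnorm : ∀ f, AEStronglyMeasurable f μ → eLpNorm (Φ f) p ν = eLpNorm f p μ)
    (hinv : ∀ f, AEStronglyMeasurable f ν → Φ (Ψ f) =ᵐ[ν] f) :
    ∃ e : Lp E p μ ≃ₗᵢ[ℝ] Lp E p ν, ∀ f, e f =ᵐ[ν] Φ f := by
  have hmem : ∀ f : Lp E p μ, MemLp (Φ f) p ν := fun f =>
    ⟨hΦ _ (Lp.aestronglyMeasurable f), by
      rw [hnorm _ (Lp.aestronglyMeasurable f)]; exact Lp.eLpNorm_lt_top f⟩
  let e₀ : Lp E p μ →ₗᵢ[ℝ] Lp E p ν :=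
    { toFun := fun f => (hmem f).toLp
      map_add' := fun f g => by
        rw [← MemLp.toLp_add, MemLp.toLp_eq_toLp_iff, ← hadd]
        exact hcongr _ _ (Lp.coeFn_add f g)
      map_smul' := fun c f => by
        rw [RingHom.id_apply, ← MemLp.toLp_const_smul, MemLp.toLp_eq_toLp_iff, ← hsmul]
        exact hcongr _ _ (Lp.coeFn_smul c f)
      norm_map' := fun f => by
        change ‖(hmem f).toLp‖ = ‖f‖
        rw [Lp.norm_toLp, hnorm _ (Lp.aestronglyMeasurable f), Lp.norm_def] }
  have he₀ : ∀ f, e₀ f =ᵐ[ν] Φ f := fun f => (hmem f).coeFn_toLp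
  have hsurj : Function.Surjective e₀ := by
    intro g
    have hg := hΨ g (Lp.aestronglyMeasurable g)
    have hgm : MemLp (Ψ g) p μ := ⟨hg, by
      rw [← hnorm _ hg, eLpNorm_congr_ae (hinv g (Lp.aestronglyMeasurable g))]
      exact Lp.eLpNorm_lt_top g⟩
    refine ⟨hgm.toLp, Lp.ext ?_⟩
    exact (he₀ _).trans ((hcongr _ _ hgm.coeFn_toLp).trans (hinv g (Lp.aestronglyMeasurable g)))
  exact ⟨LinearIsometryEquiv.ofSurjective e₀ hsurj, he₀⟩

/-- Weighted composition operators. -/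
theorem exists_weighted_composition [Fact (1 ≤ p)] {φ ψ : ℝ → ℝ} (h : IsAEInverse μ ν φ ψ)
    {w : ℝ → ℝ} (hw : Measurable w) (hw0 : ∀ u, w u ≠ 0)
    (hnorm : ∀ f : ℝ → E, AEStronglyMeasurable f μ →
      eLpNorm (fun u => w u • f (φ u)) p ν = eLpNorm f p μ) :
    ∃ e : Lp E p μ ≃ₗᵢ[ℝ] Lp E p ν, ∀ f, e f =ᵐ[ν] fun u => w u • f (φ u) := by
  refine exists_lp_isometry (fun f u => w u • f (φ u)) (fun g t => (w (ψ t))⁻¹ • g (ψ t))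
    (fun f hf => ?_) (fun f hf => ?_) (fun f g hfg => ?_) (fun f g => ?_) (fun c f => ?_) hnorm
    (fun f hf => ?_)
  · exact hw.aestronglyMeasurable.smul (hf.comp_quasiMeasurePreserving h.qmp)
  · exact (hw.comp h.qmp_inv.measurable).inv.aestronglyMeasurable.smul
      (hf.comp_quasiMeasurePreserving h.qmp_inv)
  · filter_upwards [h.qmp.ae hfg] with u hu
    rw [hu]
  · ext u; simp
  · ext u; simp [smul_comm (w u) c]
  · filter_upwards [h.right] with u hu
    simp only [hu]
    rw [smul_inv_smul₀ (hw0 u)]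

theorem aestronglyMeasurable_piecewise_isometry {j : ℝ → ℕ} (hj : Measurable j)
    (T : ℕ → E ≃ₗᵢ[ℝ] E) {f : ℝ → E} (hf : AEStronglyMeasurable f μ) :
    AEStronglyMeasurable (fun t => T (j t) (f t)) μ := by
  have hU : (⋃ n, j ⁻¹' {n}) = Set.univ := by
    ext t; simp
  rw [← Measure.restrict_univ (μ := μ), ← hU, aestronglyMeasurable_iUnion_iff]
  intro n
  have h1 : AEStronglyMeasurable (fun t => T n (f t)) (μ.restrict (j ⁻¹' {n})) :=
    (T n).continuous.comp_aestronglyMeasurable hf.restrict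
  refine h1.congr ?_
  filter_upwards [ae_restrict_mem (hj (measurableSet_singleton n))] with t ht
  rw [show j t = n from ht]

/-- Isometries acting pointwise, with countably many different isometries. -/
theorem exists_piecewise_isometry [Fact (1 ≤ p)] {j : ℝ → ℕ} (hj : Measurable j)
    (T : ℕ → E ≃ₗᵢ[ℝ] E) :
    ∃ e : Lp E p μ ≃ₗᵢ[ℝ] Lp E p μ, ∀ f, e f =ᵐ[μ] fun t => T (j t) (f t) := by
  refine exists_lp_isometry (fun f t => T (j t) (f t)) (fun f t => (T (j t)).symm (f t))
    (fun f hf => aestronglyMeasurable_piecewise_isometry hj T hf)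
    (fun f hf => aestronglyMeasurable_piecewise_isometry hj (fun n => (T n).symm) hf)
    (fun f g hfg => ?_) (fun f g => ?_) (fun c f => ?_) (fun f hf => ?_) (fun f hf => ?_)
  · filter_upwards [hfg] with t ht
    rw [ht]
  · ext t; simp
  · ext t; simp
  · exact eLpNorm_congr_norm_ae (Eventually.of_forall fun t => by simp)
  · exact Eventually.of_forall fun t => by simp

/-- A strongly measurable function has arbitrarily small oscillation on the pieces of a suitable
countable measurable partition. -/
theorem exists_index_of_stronglyMeasurable {F : Type*} [PseudoMetricSpace F] {f : ℝ → F}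
    (hf : StronglyMeasurable f) {ε : ℝ} (hε : 0 < ε) :
    ∃ j : ℝ → ℕ, Measurable j ∧ ∀ s t, j s = j t → dist (f s) (f t) < ε := by
  classical
  have hsep := hf.isSeparable_range
  obtain ⟨c, hc, hcd⟩ := hsep
  have hne : c.Nonempty := by
    rw [← closure_nonempty_iff]
    exact ⟨f 0, hcd ⟨0, rfl⟩⟩
  obtain ⟨d, rfl⟩ := hc.exists_eq_range hne
  have hex : ∀ t, ∃ n, dist (f t) (d n) < ε / 2 := by
    intro t
    obtain ⟨_, ⟨n, rfl⟩, hn⟩ := Metric.mem_closure_iff.1 (hcd ⟨t, rfl⟩) (ε / 2) (half_pos hε)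
    exact ⟨n, hn⟩
  refine ⟨fun t => Nat.find (hex t), measurable_find hex fun k => ?_, fun s t hst => ?_⟩
  · exact (hf.dist stronglyMeasurable_const).measurable measurableSet_Iio
  · have h1 := Nat.find_spec (hex s)
    have h2 := Nat.find_spec (hex t)
    rw [show Nat.find (hex s) = Nat.find (hex t) from hst] at h1
    have := dist_triangle_right (f s) (f t) (d (Nat.find (hex t)))
    linarith

end LpIsometries

/-! ### Passing from `E` to `L^p(E)` for finite `p` -/

section BochnerSpaces

theorem IsAEInverse.of_absolutelyContinuous {μ μ' ν : Measure ℝ} {φ ψ : ℝ → ℝ}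
    (h : IsAEInverse μ ν φ ψ) (h1 : μ ≪ μ') (h2 : μ' ≪ μ) : IsAEInverse μ' ν φ ψ where
  qmp := h.qmp.mono_right h1
  qmp_inv := h.qmp_inv.mono_left h2
  left := h2.ae_le h.left
  right := h.right

variable {E : Type*} [NormedAddCommGroup E] [NormedSpace ℝ E] {p : ℝ≥0∞} [Fact (1 ≤ p)]

theorem Lp.norm_le_of_ae_norm_le {E : Type*} [NormedAddCommGroup E] {p : ℝ≥0∞}
    {μ : Measure ℝ} [IsProbabilityMeasure μ] {f : Lp E p μ} {C : ℝ}
    (hC : 0 ≤ C) (h : ∀ᵐ t ∂μ, ‖f t‖ ≤ C) : ‖f‖ ≤ C := by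
  have := Lp.norm_le_of_ae_bound hC h
  simpa [measureUnivNNReal] using this

theorem Lp.coeFn_finsetSum {E : Type*} [NormedAddCommGroup E] {p : ℝ≥0∞}
    {μ : Measure ℝ} {κ : Type*} (s : Finset κ) (f : κ → Lp E p μ) :
    ⇑(∑ k ∈ s, f k) =ᵐ[μ] fun t => ∑ k ∈ s, f k t := by
  classical
  induction s using Finset.induction_on with
  | empty =>
    simp only [Finset.sum_empty]
    exact Lp.coeFn_zero E p μ
  | insert a s ha ih =>
    rw [Finset.sum_insert ha]
    filter_upwards [Lp.coeFn_add (f a) (∑ k ∈ s, f k), ih] with t h1 h2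
    rw [h1, Pi.add_apply, h2, Finset.sum_insert ha]

theorem Lp.coeFn_sub_smul_sum {E : Type*} [NormedAddCommGroup E] [NormedSpace ℝ E] {p : ℝ≥0∞}
    {μ : Measure ℝ} {κ : Type*} [Fintype κ] (c : ℝ) (g : Lp E p μ)
    (f : κ → Lp E p μ) :
    ⇑(g - c • ∑ k, f k) =ᵐ[μ] fun t => g t - c • ∑ k, f k t := by
  filter_upwards [Lp.coeFn_sub g (c • ∑ k, f k), Lp.coeFn_smul c (∑ k, f k),
    Lp.coeFn_finsetSum Finset.univ f] with t h1 h2 h3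
  rw [h1, Pi.sub_apply, h2, Pi.smul_apply, h3]

/-- Functions of constant norm one are approximated by averages of pointwise rotations. -/
theorem exists_average_of_ae_norm_eq_one {κ : Type*} [Fintype κ] [Nonempty κ] {ε δ : ℝ}
    (hE : RotationAverageApprox E κ ε) (hε : 0 ≤ ε) (hδ : 0 < δ) {u v : Lp E p unitLebesgue}
    (hu : ∀ᵐ t ∂unitLebesgue, ‖u t‖ = 1) (hv : ∀ᵐ t ∂unitLebesgue, ‖v t‖ = 1) :
    ∃ T : κ → Lp E p unitLebesgue ≃ₗᵢ[ℝ] Lp E p unitLebesgue,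
      ‖v - (Fintype.card κ : ℝ)⁻¹ • ∑ k, T k u‖ ≤ ε + 2 * δ := by
  classical
  -- Partitioning for the pair makes `u` and `v` both vary by less than `δ` on each piece, so
  -- rotations chosen at one sample point serve the whole piece.
  obtain ⟨j, hj, hjd⟩ := exists_index_of_stronglyMeasurable
    ((Lp.stronglyMeasurable u).prodMk (Lp.stronglyMeasurable v)) hδ
  have key : ∀ n, ∃ T : κ → E ≃ₗᵢ[ℝ] E, ∀ t, j t = n → ‖u t‖ = 1 → ‖v t‖ = 1 →
      ‖v t - (Fintype.card κ : ℝ)⁻¹ • ∑ k, T k (u t)‖ ≤ ε + 2 * δ := by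
    intro n
    by_cases h : ∃ s, j s = n ∧ ‖u s‖ = 1 ∧ ‖v s‖ = 1
    · obtain ⟨s, hs, hus, hvs⟩ := h
      obtain ⟨T, hT⟩ := hE _ _ hus hvs
      refine ⟨T, fun t ht _ _ => ?_⟩
      have hd := hjd t s (ht.trans hs.symm)
      rw [Prod.dist_eq, max_lt_iff, dist_eq_norm, dist_eq_norm] at hd
      have hav : ‖(Fintype.card κ : ℝ)⁻¹ • ∑ k, T k (u t - u s)‖ ≤ δ :=
        norm_average_le _ fun k => by rw [LinearIsometryEquiv.norm_map]; exact hd.1.le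
      have heq : v t - (Fintype.card κ : ℝ)⁻¹ • ∑ k, T k (u t) =
          (v t - v s) + (v s - (Fintype.card κ : ℝ)⁻¹ • ∑ k, T k (u s)) -
          (Fintype.card κ : ℝ)⁻¹ • ∑ k, T k (u t - u s) := by
        simp only [map_sub, Finset.sum_sub_distrib, smul_sub]
        abel
      rw [heq]
      refine (norm_sub_le _ _).trans ?_
      have := norm_add_le (v t - v s) (v s - (Fintype.card κ : ℝ)⁻¹ • ∑ k, T k (u s))
      linarith [hd.2]
    · exact ⟨fun _ => LinearIsometryEquiv.refl ℝ E, fun t h1 h2 h3 => absurd ⟨t, h1, h2, h3⟩ h⟩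
  choose T hT using key
  choose S hS using fun k =>
    exists_piecewise_isometry (p := p) (μ := unitLebesgue) hj (fun n => T n k)
  refine ⟨S, Lp.norm_le_of_ae_norm_le (by positivity) ?_⟩
  filter_upwards [Lp.coeFn_sub_smul_sum (Fintype.card κ : ℝ)⁻¹ v (fun k => S k u), hu, hv,
    ae_all_iff.2 fun k => hS k u] with t h1 h2 h3 h4
  rw [h1]
  simp only [h4]
  exact hT (j t) t rfl h2 h3

/-- A nowhere vanishing unit vector of a Bochner space can be rotated to a function whose values
are unit vectors. -/
theorem exists_isometry_to_norm_eq_one (hp : p ≠ ∞) {f : ℝ → E} (hf : StronglyMeasurable f)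
    (hf0 : ∀ t, f t ≠ 0) (hf1 : eLpNorm f p unitLebesgue = 1) :
    ∃ J : Lp E p unitLebesgue ≃ₗᵢ[ℝ] Lp E p unitLebesgue,
      ∀ F : Lp E p unitLebesgue, F =ᵐ[unitLebesgue] f →
        ∀ᵐ u ∂unitLebesgue, ‖J F u‖ = 1 := by
  have hp0 : p ≠ 0 := (zero_lt_one.trans_le (Fact.out : 1 ≤ p)).ne'
  have hq : 0 < p.toReal := ENNReal.toReal_pos hp0 hp
  set q := p.toReal with hqdef
  set ρ : ℝ → ℝ≥0∞ := fun t => ‖f t‖ₑ ^ q with hρ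
  have hρm : Measurable ρ := hf.enorm.pow_const q
  have hfe0 : ∀ t, ‖f t‖ₑ ≠ 0 := fun t => enorm_ne_zero.2 (hf0 t)
  have hρ0 : ∀ t, ρ t ≠ 0 := fun t => by
    simp [hρ, ENNReal.rpow_eq_zero_iff, hf0 t, hq.not_gt]
  have hint : ∫⁻ t, ρ t ∂unitLebesgue = 1 := by
    rw [eLpNorm_eq_lintegral_rpow_enorm_toReal hp0 hp, ← hqdef] at hf1
    have h := congrArg (fun x : ℝ≥0∞ => x ^ q) hf1
    simpa only [← ENNReal.rpow_mul, one_div, inv_mul_cancel₀ hq.ne', ENNReal.rpow_one,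
      ENNReal.one_rpow] using h
  -- Transporting this measure to Lebesgue measure absorbs a factor `‖f‖ ^ q` in the integral, which
  -- the weight `‖f (φ u)‖⁻¹` cancels. As the density never vanishes, both measures have the same
  -- null sets.
  let μ := unitLebesgue.withDensity ρ
  have : IsProbabilityMeasure μ := ⟨by
    rw [withDensity_apply _ MeasurableSet.univ, Measure.restrict_univ, hint]⟩
  obtain ⟨φ, ψ, hmap, hiso, -⟩ := exists_measure_isomorphism μ
  have hac : μ ≪ unitLebesgue := withDensity_absolutelyContinuous _ _
  have hac' : unitLebesgue ≪ μ :=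
    withDensity_absolutelyContinuous' hρm.aemeasurable (ae_of_all _ hρ0)
  have hw : Measurable fun u => ‖f (φ u)‖⁻¹ :=
    (hf.norm.measurable.comp hiso.qmp.measurable).inv
  obtain ⟨J, hJ⟩ := exists_weighted_composition (E := E) (p := p)
    (hiso.of_absolutelyContinuous hac hac') hw
    (fun u => inv_ne_zero (norm_ne_zero_iff.2 (hf0 _))) (fun g hg => by
      rw [eLpNorm_eq_lintegral_rpow_enorm_toReal hp0 hp,
        eLpNorm_eq_lintegral_rpow_enorm_toReal hp0 hp]
      congr 1
      let G : ℝ → ℝ≥0∞ := fun t => ‖‖f t‖⁻¹ • g t‖ₑ ^ q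
      have hG : AEMeasurable G unitLebesgue :=
        (hf.norm.measurable.inv.aestronglyMeasurable.smul hg).enorm.pow_const q
      calc ∫⁻ u, ‖‖f (φ u)‖⁻¹ • g (φ u)‖ₑ ^ q ∂unitLebesgue
          = ∫⁻ u, G (φ u) ∂unitLebesgue := rfl
        _ = ∫⁻ t, G t ∂μ := by
            rw [← hmap, lintegral_map' (by rw [hmap]; exact hG.mono_ac hac)
              hiso.qmp.measurable.aemeasurable]
        _ = ∫⁻ t, (ρ * G) t ∂unitLebesgue :=
            lintegral_withDensity_eq_lintegral_mul₀ hρm.aemeasurable hG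
        _ = ∫⁻ t, ‖g t‖ₑ ^ q ∂unitLebesgue := by
            refine lintegral_congr fun t => ?_
            simp only [Pi.mul_apply, hρ, G]
            rw [← ENNReal.mul_rpow_of_nonneg _ _ hq.le, enorm_smul,
              enorm_inv (norm_ne_zero_iff.2 (hf0 t)), enorm_norm, ← mul_assoc,
              ENNReal.mul_inv_cancel (hfe0 t) enorm_ne_top, one_mul])
  refine ⟨J, fun F hF => ?_⟩
  filter_upwards [hJ F, (hiso.of_absolutelyContinuous hac hac').qmp.ae hF] with u h1 h2
  rw [h1, h2, norm_smul, norm_inv, norm_norm, inv_mul_cancel₀ (norm_ne_zero_iff.2 (hf0 _))]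

/-- Up to a small error, every unit vector of a Bochner space can be rotated to a function whose
values are unit vectors. -/
theorem exists_isometry_near_norm_eq_one (hp : p ≠ ∞) {f : Lp E p unitLebesgue} (hf : ‖f‖ = 1)
    {ε : ℝ} (hε : 0 < ε) :
    ∃ (J : Lp E p unitLebesgue ≃ₗᵢ[ℝ] Lp E p unitLebesgue) (u : Lp E p unitLebesgue),
      ‖J f - u‖ ≤ ε ∧ ∀ᵐ t ∂unitLebesgue, ‖u t‖ = 1 := by
  classical
  -- One `δ` pays for removing the zeros of `f`, another for renormalising; `δ < 1` keeps the new
  -- norm `c` positive.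
  obtain ⟨δ, hδ0, hδ1, hδε⟩ : ∃ δ : ℝ, 0 < δ ∧ δ < 1 ∧ 2 * δ ≤ ε :=
    ⟨min (1 / 2) (ε / 2), by positivity, (min_le_left _ _).trans_lt (by norm_num), by
      linarith [min_le_right (1 / 2) (ε / 2)]⟩
  have hne : ∃ x : E, x ≠ 0 := by
    by_contra hcon
    push Not at hcon
    have : f = 0 :=
      Lp.ext (Eventually.of_forall fun t => by rw [hcon (f t), hcon ((0 : Lp E p _) t)])
    simp [this] at hf
  obtain ⟨x, hx⟩ := hne
  set x₀ : E := (δ / ‖x‖) • x with hx₀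
  have hx₀n : ‖x₀‖ = δ := by
    rw [hx₀, norm_smul, norm_div, norm_norm, Real.norm_of_nonneg hδ0.le,
      div_mul_cancel₀ _ (norm_ne_zero_iff.2 hx)]
  have hx₀0 : x₀ ≠ 0 := norm_pos_iff.1 (by rw [hx₀n]; exact hδ0)
  have hfm := Lp.stronglyMeasurable f
  -- The zeros of `f` are filled with a vector of norm `δ`, since the change of density needs a
  -- nowhere vanishing function.
  let g : ℝ → E := fun t => if f t = 0 then x₀ else f t
  have hgm : StronglyMeasurable g :=
    StronglyMeasurable.ite (hfm.measurableSet_eq_fun stronglyMeasurable_const)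
      stronglyMeasurable_const hfm
  have hg0 : ∀ t, g t ≠ 0 := by
    intro t
    by_cases h : f t = 0
    · simpa [g, h] using hx₀0
    · simp [g, h]
  have hfg : ∀ t, ‖f t - g t‖ ≤ δ := by
    intro t
    by_cases h : f t = 0
    · simp [g, h, hx₀n]
    · simp [g, h, hδ0.le]
  have hdiff : MemLp (fun t => f t - g t) p unitLebesgue :=
    MemLp.of_bound (hfm.sub hgm).aestronglyMeasurable δ (Eventually.of_forall hfg)
  have hgL : MemLp g p unitLebesgue := by
    have := (Lp.memLp f).sub hdiff
    refine this.ae_eq (Eventually.of_forall fun t => ?_)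
    simp
  have hd : ‖f - hgL.toLp‖ ≤ δ := by
    refine Lp.norm_le_of_ae_norm_le hδ0.le ?_
    filter_upwards [Lp.coeFn_sub f hgL.toLp, hgL.coeFn_toLp] with t h1 h2
    rw [h1, Pi.sub_apply, h2]
    exact hfg t
  set c := ‖hgL.toLp‖ with hc
  have hc1 : |1 - c| ≤ δ := by
    rw [← hf]
    exact (abs_norm_sub_norm_le _ _).trans hd
  have hc0 : 0 < c := by linarith [(abs_le.1 hc1).2]
  have hGn : eLpNorm (fun t => c⁻¹ • g t) p unitLebesgue = 1 := by
    have h1 : eLpNorm g p unitLebesgue = ENNReal.ofReal c := by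
      rw [hc, Lp.norm_toLp, ENNReal.ofReal_toReal hgL.2.ne]
    have h2 := eLpNorm_const_smul c⁻¹ g p unitLebesgue
    rw [h1, Real.enorm_eq_ofReal (by positivity), ← ENNReal.ofReal_mul (by positivity),
      inv_mul_cancel₀ hc0.ne', ENNReal.ofReal_one] at h2
    exact h2
  obtain ⟨J, hJ⟩ := exists_isometry_to_norm_eq_one hp (hgm.const_smul c⁻¹)
    (fun t => smul_ne_zero (inv_ne_zero hc0.ne') (hg0 t)) hGn
  refine ⟨J, J (c⁻¹ • hgL.toLp), ?_, hJ _ ?_⟩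
  · rw [← map_sub, LinearIsometryEquiv.norm_map]
    have h3 : ‖hgL.toLp - c⁻¹ • hgL.toLp‖ ≤ δ := by
      have : hgL.toLp - c⁻¹ • hgL.toLp = (1 - c⁻¹) • hgL.toLp := by rw [sub_smul, one_smul]
      rw [this, norm_smul, ← hc, Real.norm_eq_abs]
      have h4 : |1 - c⁻¹| * c = |1 - c| := by
        nth_rewrite 2 [← abs_of_pos hc0]
        rw [← abs_mul, sub_mul, inv_mul_cancel₀ hc0.ne', one_mul, abs_sub_comm]
      rw [h4]
      exact hc1
    have := norm_sub_le_norm_sub_add_norm_sub f hgL.toLp (c⁻¹ • hgL.toLp)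
    linarith
  · filter_upwards [Lp.coeFn_smul c⁻¹ hgL.toLp, hgL.coeFn_toLp] with t h1 h2
    rw [h1, Pi.smul_apply, h2, Pi.smul_apply]

/-- Uniform approximation by averages of rotations passes from `E` to the Bochner spaces
`L^p(E)`, `p < ∞`. -/
theorem RotationAverageApprox.lp (hp : p ≠ ∞) {κ : Type*} [Fintype κ] [Nonempty κ] {ε ε' : ℝ}
    (hE : RotationAverageApprox E κ ε) (hε : 0 ≤ ε) (hεε' : ε < ε') :
    RotationAverageApprox (Lp E p unitLebesgue) κ ε' := by
  intro x y hx hy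
  -- The moves by `J` and `K` cost `δ` each and the piecewise matching `2 * δ`.
  set δ := (ε' - ε) / 4 with hδ
  have hδ0 : 0 < δ := by rw [hδ]; linarith
  obtain ⟨J, u, hJu, hu⟩ := exists_isometry_near_norm_eq_one hp hx hδ0
  obtain ⟨K, v, hKv, hv⟩ := exists_isometry_near_norm_eq_one hp hy hδ0
  obtain ⟨T, hT⟩ := exists_average_of_ae_norm_eq_one hE hε hδ0 hu hv
  refine ⟨fun k => (J.trans (T k)).trans K.symm, ?_⟩
  have hav : ‖(Fintype.card κ : ℝ)⁻¹ • ∑ k, T k (J x - u)‖ ≤ δ :=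
    norm_average_le _ fun k => by rw [LinearIsometryEquiv.norm_map]; exact hJu
  rw [← K.norm_map]
  have heq : K (y - (Fintype.card κ : ℝ)⁻¹ • ∑ k, ((J.trans (T k)).trans K.symm) x) =
      (K y - v) + (v - (Fintype.card κ : ℝ)⁻¹ • ∑ k, T k u) -
      (Fintype.card κ : ℝ)⁻¹ • ∑ k, T k (J x - u) := by
    simp only [map_sub, map_smul, map_sum, LinearIsometryEquiv.trans_apply,
      LinearIsometryEquiv.apply_symm_apply, Finset.sum_sub_distrib, smul_sub]
    abel
  rw [heq]
  refine (norm_sub_le _ _).trans ?_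
  have := norm_add_le (K y - v) (v - (Fintype.card κ : ℝ)⁻¹ • ∑ k, T k u)
  linarith

end BochnerSpaces

/-! ### Real `L^∞` -/

section EssentiallyBounded

open ProbabilityTheory

/-- A measurable set of positive measure whose complement has positive measure can be moved onto
the left half of the unit interval. -/
theorem exists_isAEInverse_half {A : Set ℝ} (hA : MeasurableSet A) (h1 : unitLebesgue A ≠ 0)
    (h2 : unitLebesgue Aᶜ ≠ 0) :
    ∃ φ ψ : ℝ → ℝ, IsAEInverse unitLebesgue unitLebesgue φ ψ ∧
      ∀ᵐ u ∂unitLebesgue, φ u ∈ A ↔ u ≤ 1 / 2 := by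
  classical
  -- This density gives `A` and its complement mass one half each without changing the null sets.
  let ρ : ℝ → ℝ≥0∞ := fun t => if t ∈ A then (2 * unitLebesgue A)⁻¹ else (2 * unitLebesgue Aᶜ)⁻¹
  have hρm : Measurable ρ := Measurable.ite hA measurable_const measurable_const
  have hρ0 : ∀ t, ρ t ≠ 0 := by
    intro t
    by_cases h : t ∈ A <;>
      simp only [ρ, h, if_true, if_false] <;>
      exact ENNReal.inv_ne_zero.2 (ENNReal.mul_ne_top ENNReal.ofNat_ne_top (measure_ne_top _ _))
  let μ₀ := unitLebesgue.withDensity ρ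
  have half : ∀ x : ℝ≥0∞, x ≠ 0 → x ≠ ∞ → (2 * x)⁻¹ * x = 2⁻¹ := by
    intro x hx hx'
    rw [ENNReal.mul_inv (Or.inl two_ne_zero) (Or.inl ENNReal.ofNat_ne_top), mul_assoc,
      ENNReal.inv_mul_cancel hx hx', mul_one]
  have hμA : μ₀ A = 2⁻¹ := by
    rw [withDensity_apply _ hA, setLIntegral_congr_fun (g := fun _ => (2 * unitLebesgue A)⁻¹) hA
      (fun t ht => by simp [ρ, ht, -Measure.restrict_apply]), setLIntegral_const]
    exact half _ h1 (measure_ne_top _ _)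
  have hμAc : μ₀ Aᶜ = 2⁻¹ := by
    rw [withDensity_apply _ hA.compl,
      setLIntegral_congr_fun (g := fun _ => (2 * unitLebesgue Aᶜ)⁻¹) hA.compl
      (fun t (ht : t ∉ A) => by simp [ρ, ht, -Measure.restrict_apply]), setLIntegral_const]
    exact half _ h2 (measure_ne_top _ _)
  have hprob₀ : IsProbabilityMeasure μ₀ := ⟨by
    rw [← measure_add_measure_compl hA, hμA, hμAc, ENNReal.inv_two_add_inv_two]⟩
  have hac : μ₀ ≪ unitLebesgue := withDensity_absolutelyContinuous _ _
  have hac' : unitLebesgue ≪ μ₀ :=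
    withDensity_absolutelyContinuous' hρm.aemeasurable (ae_of_all _ hρ0)
  -- Shifting the complement by `2` places `A` entirely to its left, with `1` in between. The cdf at
  -- `1` is then `1 / 2`, and the quantile map sends the left half of the interval to `A`.
  let s : ℝ → ℝ := fun t => if t ∈ A then t else t + 2
  let r : ℝ → ℝ := fun t => if t ≤ 1 then t else t - 2
  have hs : Measurable s := Measurable.ite hA measurable_id (measurable_id.add_const 2)
  have hr : Measurable r := Measurable.ite measurableSet_Iic measurable_id
    (measurable_id.sub_const 2)
  have hsr : ∀ t ∈ Set.Ioo (0 : ℝ) 1, r (s t) = t ∧ (s t ≤ 1 ↔ t ∈ A) := by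
    rintro t ⟨ht0, ht1⟩
    by_cases h : t ∈ A
    · have : s t = t := by simp [s, h]
      rw [this]
      exact ⟨by simp [r, ht1.le], by simp [h, ht1.le]⟩
    · have h3 : s t = t + 2 := by simp [s, h]
      have h4 : ¬ t + 2 ≤ 1 := by linarith
      rw [h3]
      exact ⟨by simp [r, h4], by simp [h, h4]⟩
  have hIoo : ∀ᵐ t ∂μ₀, t ∈ Set.Ioo (0 : ℝ) 1 := hac.ae_le ae_mem_Ioo_unitLebesgue
  let μ := μ₀.map s
  have hprob : IsProbabilityMeasure μ := Measure.isProbabilityMeasure_map hs.aemeasurable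
  have hatom : NullSingletonClass μ := ⟨fun x => by
    rw [Measure.map_apply hs (measurableSet_singleton x)]
    refine measure_mono_null (t := {x, x - 2}) (fun t (ht : s t = x) => ?_)
      (Set.Countable.measure_zero (Set.to_countable _) _)
    by_cases h : t ∈ A
    · left
      simpa [s, h] using ht
    · right
      simp only [s, h, if_false] at ht
      simp [← ht]⟩
  have h₀ : IsAEInverse μ μ₀ s r :=
    isAEInverse_of_left_inverse hs hr rfl (hIoo.mono fun t ht => (hsr t ht).1)
  obtain ⟨φ, ψ, -, hiso, hφ⟩ := exists_measure_isomorphism μ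
  have hcdf : cdf μ 1 = 1 / 2 := by
    have h3 : (s ⁻¹' Set.Iic 1 : Set ℝ) =ᵐ[μ₀] A :=
      hIoo.mono fun t ht => propext (hsr t ht).2
    rw [cdf_eq_real, measureReal_def, Measure.map_apply hs measurableSet_Iic, measure_congr h3,
      hμA]
    simp
  refine ⟨r ∘ φ, ψ ∘ s, (h₀.symm.comp hiso).of_absolutelyContinuous hac hac', ?_⟩
  have h4 : ∀ᵐ x ∂μ, x ≤ 1 ↔ r x ∈ A := by
    filter_upwards [h₀.qmp_inv.ae (hIoo.mono fun t ht => (hsr t ht).2), h₀.left] with x hx hx'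
    rwa [hx'] at hx
  filter_upwards [hiso.qmp.ae h4, hφ] with u hu hu'
  rw [Function.comp_apply, ← hu, hu' 1, hcdf]

/-- Null-preserving isomorphisms act transitively on the measurable sets that are neither null nor
conull. -/
theorem exists_isAEInverse_mem {A B : Set ℝ} (hA : MeasurableSet A) (hA1 : unitLebesgue A ≠ 0)
    (hA2 : unitLebesgue Aᶜ ≠ 0) (hB : MeasurableSet B) (hB1 : unitLebesgue B ≠ 0)
    (hB2 : unitLebesgue Bᶜ ≠ 0) :
    ∃ φ ψ : ℝ → ℝ, IsAEInverse unitLebesgue unitLebesgue φ ψ ∧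
      ∀ᵐ t ∂unitLebesgue, t ∈ B → φ t ∈ A := by
  obtain ⟨φ, ψ, h, hφ⟩ := exists_isAEInverse_half hA hA1 hA2
  obtain ⟨φ', ψ', h', hφ'⟩ := exists_isAEInverse_half hB hB1 hB2
  refine ⟨φ ∘ ψ', φ' ∘ ψ, h.comp h'.symm, ?_⟩
  filter_upwards [h'.qmp_inv.ae hφ, h'.qmp_inv.ae hφ', h'.left] with t h1 h2 h3 ht
  rw [h3] at h2
  exact h1.2 (h2.1 ht)

/-- The essential supremum sees only null sets, so no measure needs to be preserved and no weight is
required. -/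
theorem IsAEInverse.eLpNorm_top_comp {E : Type*} [NormedAddCommGroup E] {μ ν : Measure ℝ}
    {φ ψ : ℝ → ℝ} (h : IsAEInverse μ ν φ ψ) (f : ℝ → E) :
    eLpNorm (fun u => f (φ u)) ∞ ν = eLpNorm f ∞ μ := by
  rw [eLpNorm_exponent_top, eLpNorm_exponent_top]
  refine le_antisymm ?_ ?_
  · exact eLpNormEssSup_le_of_ae_enorm_bound
      (h.qmp.ae (ae_le_eLpNormEssSup (f := f) (μ := μ)))
  · refine eLpNormEssSup_le_of_ae_enorm_bound ?_
    filter_upwards [h.left, h.qmp_inv.ae (ae_le_eLpNormEssSup (f := fun u => f (φ u)) (μ := ν))]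
      with t h1 h2
    rwa [h1] at h2

theorem Lp.ae_norm_le_of_norm_le {E : Type*} [NormedAddCommGroup E] {μ : Measure ℝ}
    (f : Lp E ∞ μ) : ∀ᵐ t ∂μ, ‖f t‖ ≤ ‖f‖ := by
  have h := ae_le_eLpNormEssSup (f := f) (μ := μ)
  filter_upwards [h] with t ht
  rw [← eLpNorm_exponent_top] at ht
  rw [Lp.norm_def, ← toReal_enorm]
  exact ENNReal.toReal_mono (Lp.eLpNorm_ne_top f) ht

/-- The set where `|f|` is nearly `1` may be conull, while `exists_isAEInverse_mem` needs a
complement of positive measure; intersecting with one of two halves repairs this. -/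
theorem exists_subset_of_measure_ne_zero {A : Set ℝ} (hA : MeasurableSet A)
    (h : unitLebesgue A ≠ 0) :
    ∃ B ⊆ A, MeasurableSet B ∧ unitLebesgue B ≠ 0 ∧ unitLebesgue Bᶜ ≠ 0 := by
  have key : ∀ C : Set ℝ, MeasurableSet C → unitLebesgue (A ∩ C) ≠ 0 → unitLebesgue Cᶜ ≠ 0 →
      ∃ B ⊆ A, MeasurableSet B ∧ unitLebesgue B ≠ 0 ∧ unitLebesgue Bᶜ ≠ 0 := by
    intro C hC h1 h2
    refine ⟨A ∩ C, Set.inter_subset_left, hA.inter hC, h1, fun h3 => h2 ?_⟩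
    exact measure_mono_null (Set.compl_subset_compl.2 Set.inter_subset_right) h3
  have hIic : unitLebesgue (Set.Iic (1 / 2)) ≠ 0 := by
    refine ne_of_gt (lt_of_lt_of_le ?_ (measure_mono (Set.Icc_subset_Iic_self (a := 0))))
    rw [Measure.restrict_apply measurableSet_Icc, Set.inter_eq_left.2
      (Set.Icc_subset_Icc_right (by norm_num))]
    simp
  have hIoi : unitLebesgue (Set.Iic (1 / 2))ᶜ ≠ 0 := by
    rw [Set.compl_Iic]
    refine ne_of_gt (lt_of_lt_of_le ?_
      (measure_mono (Set.Ioc_subset_Ioi_self : Set.Ioc (1 / 2 : ℝ) 1 ⊆ _)))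
    rw [Measure.restrict_apply measurableSet_Ioc, Set.inter_eq_left.2
      (Set.Ioc_subset_Icc_self.trans (Set.Icc_subset_Icc_left (by norm_num)))]
    simp only [Real.volume_Ioc, ENNReal.ofReal_pos]
    norm_num
  by_cases h0 : unitLebesgue (A ∩ Set.Iic (1 / 2)) = 0
  · refine key _ measurableSet_Iic.compl (fun h1 => h ?_) (by rwa [compl_compl])
    rw [← measure_inter_add_sdiff A measurableSet_Iic, h0, zero_add]
    exact h1
  · exact key _ measurableSet_Iic h0 hIoi

theorem sum_sign_eq (n : ℕ) {z : ℝ} (hz : z ≤ n) :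
    ∑ j : Fin n, (if (j : ℝ) < z then (1 : ℝ) else -1) = 2 * ⌈z⌉₊ - n := by
  have hc : ⌈z⌉₊ ≤ n := Nat.ceil_le.2 hz
  have h1 : ∀ j : ℕ, (if (j : ℝ) < z then (1 : ℝ) else -1) =
      2 * (if j ∈ Finset.range ⌈z⌉₊ then 1 else 0) - 1 := by
    intro j
    simp only [Finset.mem_range, Nat.lt_ceil]
    split_ifs <;> norm_num
  rw [Fin.sum_univ_eq_sum_range (fun j : ℕ => if (j : ℝ) < z then (1 : ℝ) else -1)]
  simp only [h1]
  rw [Finset.sum_sub_distrib, ← Finset.mul_sum, Finset.sum_ite_mem,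
    Finset.inter_eq_right.2 (Finset.range_subset_range.2 hc)]
  simp

/-- A number in `[-1, 1]` is the average of `n` signs up to an error `2 / n`. -/
theorem abs_sub_average_sign_le {n : ℕ} (hn : 0 < n) {y : ℝ} (hy : |y| ≤ 1) :
    |y - (n : ℝ)⁻¹ * ∑ j : Fin n, (if (j : ℝ) < n * (1 + y) / 2 then (1 : ℝ) else -1)| ≤
      2 / n := by
  have hn' : (0 : ℝ) < n := by exact_mod_cast hn
  obtain ⟨h1, h2⟩ := abs_le.1 hy
  have hz0 : 0 ≤ n * (1 + y) / 2 := by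
    have : 0 ≤ 1 + y := by linarith
    positivity
  rw [sum_sign_eq n (by nlinarith)]
  have h3 := Nat.le_ceil (n * (1 + y) / 2)
  have h4 := Nat.ceil_lt_add_one hz0
  have h5 : y - (n : ℝ)⁻¹ * (2 * ⌈n * (1 + y) / 2⌉₊ - n) =
      2 * (n * (1 + y) / 2 - ⌈n * (1 + y) / 2⌉₊) / n := by
    field_simp
    ring
  rw [h5, abs_div, abs_of_pos hn']
  gcongr
  rw [abs_le]
  constructor <;> linarith

/-- A single exceptional term costs at most `1 / n` in the average. -/
theorem abs_one_sub_average_le {n : ℕ} (hn : 0 < n) {δ : ℝ} (hδ : 0 ≤ δ) (m : ℕ) (b : Fin n → ℝ)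
    (h0 : ∀ k, 0 ≤ b k) (h1 : ∀ k, b k ≤ 1) (h : ∀ k : Fin n, (k : ℕ) ≠ m → 1 - δ ≤ b k) :
    |1 - (n : ℝ)⁻¹ * ∑ k, b k| ≤ δ + 1 / n := by
  have hn' : (0 : ℝ) < n := by exact_mod_cast hn
  have h2 : 1 - (n : ℝ)⁻¹ * ∑ k, b k = (∑ k, (1 - b k)) / n := by
    rw [Finset.sum_sub_distrib]
    simp
    field_simp
  have h3 : ∑ k, (1 - b k) ≤ ∑ k : Fin n, (δ + if (k : ℕ) = m then 1 else 0) := by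
    refine Finset.sum_le_sum fun k _ => ?_
    split_ifs with hk
    · linarith [h0 k]
    · linarith [h k hk]
  have h4 : ∑ k : Fin n, (if (k : ℕ) = m then (1 : ℝ) else 0) ≤ 1 := by
    rw [Fin.sum_univ_eq_sum_range (fun k : ℕ => if k = m then (1 : ℝ) else 0),
      Finset.sum_ite_eq']
    split_ifs <;> norm_num
  rw [Finset.sum_add_distrib] at h3
  simp only [Finset.sum_const, Finset.card_univ, Fintype.card_fin, nsmul_eq_mul] at h3
  have h5 : 0 ≤ ∑ k, (1 - b k) := Finset.sum_nonneg fun k _ => by linarith [h1 k]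
  rw [h2, abs_of_nonneg (by positivity), div_le_iff₀ hn', add_mul, one_div,
    inv_mul_cancel₀ hn'.ne']
  linarith

/-- Real `L^∞` has uniform approximation by averages of rotations. -/
theorem rotationAverageApprox_Linfty {ε : ℝ} (hε : 0 < ε) :
    ∃ n : ℕ, 1 ≤ n ∧ RotationAverageApprox (Lp ℝ ∞ unitLebesgue) (Fin n) ε := by
  classical
  -- `n > 2` ensures that an interval of length `1 / n` is not conull. The errors are `2 / n` for
  -- signs, `1 / n` for one bad interval and `ε / 2` for the values of `|f|` on `A`.
  obtain ⟨n, hn⟩ := exists_nat_gt (max 2 (3 / (ε / 2)))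
  have hn2 : (2 : ℝ) < n := (le_max_left _ _).trans_lt hn
  have hnε : 3 / (n : ℝ) ≤ ε / 2 := by
    have := (le_max_right _ _).trans_lt hn
    rw [div_lt_iff₀ (by positivity)] at this
    rw [div_le_iff₀ (by linarith)]
    linarith
  have hn' : (0 : ℝ) < n := by linarith
  have hn0 : 0 < n := by exact_mod_cast hn'
  -- One index runs over sign patterns, the other over automorphisms; the average then factors into
  -- a product of two averages.
  suffices H : RotationAverageApprox (Lp ℝ ∞ unitLebesgue) (Fin n × Fin n) ε from
    ⟨n * n, Nat.mul_pos hn0 hn0, H.congr finProdFinEquiv.symm⟩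
  intro f g hf hg
  have hfm := (Lp.stronglyMeasurable f).measurable
  have hgm := (Lp.stronglyMeasurable g).measurable
  have hf1 := Lp.ae_norm_le_of_norm_le f
  have hg1 := Lp.ae_norm_le_of_norm_le g
  rw [hf] at hf1
  rw [hg] at hg1
  have hA₀ : MeasurableSet {t | 1 - ε / 2 < |f t|} := measurableSet_lt measurable_const hfm.abs
  have hA₀' : unitLebesgue {t | 1 - ε / 2 < |f t|} ≠ 0 := by
    intro h0
    have h1 : ∀ᵐ t ∂unitLebesgue, ‖f t‖ ≤ max 0 (1 - ε / 2) := by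
      have : ∀ᵐ t ∂unitLebesgue, ¬ 1 - ε / 2 < |f t| := measure_eq_zero_iff_ae_notMem.1 h0
      exact this.mono fun t ht => le_max_of_le_right (not_lt.1 ht)
    have h2 := Lp.norm_le_of_ae_norm_le (le_max_left _ _) h1
    rw [hf] at h2
    rcases le_max_iff.1 h2 with h3 | h3 <;> linarith
  obtain ⟨A, hAsub, hA, hA1, hA2⟩ := exists_subset_of_measure_ne_zero hA₀ hA₀'
  let I : Fin n → Set ℝ := fun k => Set.Ico ((k : ℝ) / n) ((k + 1) / n)
  have hI : ∀ k, unitLebesgue (I k) = ENNReal.ofReal (1 / n) := by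
    intro k
    have hk : ((k : ℕ) : ℝ) + 1 ≤ n := by exact_mod_cast k.2
    have hsub : I k ⊆ Set.Icc 0 1 := by
      rintro t ⟨ht1, ht2⟩
      refine ⟨le_trans (by positivity) ht1, ht2.le.trans ?_⟩
      rwa [div_le_one hn']
    rw [Measure.restrict_apply measurableSet_Ico, Set.inter_eq_left.2 hsub, Real.volume_Ico]
    congr 1
    ring
  -- The intervals `I k` are disjoint, so for a given `t` at most one `φ k` can fail to send `t`
  -- into `A`, off a null set.
  have hφ : ∀ k : Fin n, ∃ φ ψ : ℝ → ℝ, IsAEInverse unitLebesgue unitLebesgue φ ψ ∧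
      ∀ᵐ t ∂unitLebesgue, t ∈ (I k)ᶜ → φ t ∈ A := by
    intro k
    refine exists_isAEInverse_mem hA hA1 hA2 measurableSet_Ico.compl ?_ ?_
    · rw [Ne, prob_compl_eq_zero_iff measurableSet_Ico, hI k, ENNReal.ofReal_eq_one]
      rw [div_eq_one_iff_eq hn'.ne']
      linarith
    · rw [compl_compl, hI k, Ne, ENNReal.ofReal_eq_zero, not_le]
      positivity
  choose φ ψ hiso hφA using hφ
  -- The signs `σ j t` average to nearly `g t`, while `τ` turns `f` into `|f|`.
  let σ : Fin n → ℝ → ℝ := fun j t => if (j : ℝ) < n * (1 + g t) / 2 then 1 else -1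
  let τ : ℝ → ℝ := fun t => if f t < 0 then -1 else 1
  have hσm : ∀ j, Measurable (σ j) := fun j => Measurable.ite
    (measurableSet_lt measurable_const (((hgm.const_add 1).const_mul _).div_const 2))
    measurable_const measurable_const
  have hτm : Measurable τ := Measurable.ite (measurableSet_lt hfm measurable_const)
    measurable_const measurable_const
  have hσ1 : ∀ j t, |σ j t| = 1 := by
    intro j t
    simp only [σ]
    split_ifs <;> simp
  have hτ1 : ∀ t, |τ t| = 1 := by
    intro t
    simp only [τ]
    split_ifs <;> simp
  have hτf : ∀ t, τ t * f t = |f t| := by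
    intro t
    simp only [τ]
    split_ifs with h
    · rw [abs_of_neg h]; ring
    · rw [abs_of_nonneg (not_lt.1 h)]; ring
  have hT : ∀ q : Fin n × Fin n, ∃ T : Lp ℝ ∞ unitLebesgue ≃ₗᵢ[ℝ] Lp ℝ ∞ unitLebesgue,
      ∀ h, T h =ᵐ[unitLebesgue] fun t => (σ q.1 t * τ (φ q.2 t)) • h (φ q.2 t) := by
    intro q
    have habs : ∀ t, |σ q.1 t * τ (φ q.2 t)| = 1 := fun t => by
      rw [abs_mul, hσ1, hτ1, mul_one]
    refine exists_weighted_composition (hiso q.2)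
      ((hσm q.1).mul (hτm.comp (hiso q.2).qmp.measurable)) (fun t h0 => ?_) (fun h _ => ?_)
    · have := habs t
      rw [h0] at this
      simp at this
    · rw [← (hiso q.2).eLpNorm_top_comp h]
      refine eLpNorm_congr_norm_ae (Eventually.of_forall fun t => ?_)
      rw [norm_smul, Real.norm_eq_abs, habs, one_mul]
  choose T hT using hT
  refine ⟨T, Lp.norm_le_of_ae_norm_le hε.le ?_⟩
  filter_upwards [Lp.coeFn_sub_smul_sum (Fintype.card (Fin n × Fin n) : ℝ)⁻¹ g (fun q => T q f),
    ae_all_iff.2 fun q => hT q f, ae_all_iff.2 hφA, hg1,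
    ae_all_iff.2 fun k => (hiso k).qmp.ae hf1, ae_mem_Ioo_unitLebesgue] with t h1 h2 h3 h4 h5 h6
  rw [h1]
  simp only [h2]
  have hsum : (Fintype.card (Fin n × Fin n) : ℝ)⁻¹ •
      ∑ q : Fin n × Fin n, (σ q.1 t * τ (φ q.2 t)) • f (φ q.2 t) =
      ((n : ℝ)⁻¹ * ∑ j, σ j t) * ((n : ℝ)⁻¹ * ∑ k, |f (φ k t)|) := by
    rw [mul_mul_mul_comm, Finset.sum_mul_sum, ← Finset.sum_product', Finset.univ_product_univ,
      Fintype.card_prod, Fintype.card_fin, Nat.cast_mul, mul_inv, smul_eq_mul]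
    congr 1
    refine Finset.sum_congr rfl fun q _ => ?_
    rw [smul_eq_mul, mul_assoc, hτf]
  rw [hsum]
  have hα := abs_sub_average_sign_le hn0 (y := g t) h4
  have : Nonempty (Fin n) := ⟨⟨0, hn0⟩⟩
  have hα1 : |(n : ℝ)⁻¹ * ∑ j, σ j t| ≤ 1 := by
    have := norm_average_le (fun j => σ j t) (c := 1) (fun j => (hσ1 j t).le)
    simpa using this
  have hβ : ‖1 - (n : ℝ)⁻¹ * ∑ k, |f (φ k t)|‖ ≤ ε / 2 + 1 / n := by
    -- The exceptional index is that of the interval `I k` containing `t`.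
    refine abs_one_sub_average_le hn0 (by positivity) ⌊n * t⌋₊ _ (fun k => abs_nonneg _) h5
      fun k hk => (hAsub (h3 k fun hkt => hk ?_)).le
    obtain ⟨ha, hb⟩ := hkt
    rw [div_le_iff₀ hn'] at ha
    rw [lt_div_iff₀ hn'] at hb
    symm
    rw [Nat.floor_eq_iff (mul_nonneg hn'.le h6.1.le)]
    constructor <;> linarith
  set α := (n : ℝ)⁻¹ * ∑ j, σ j t with hαdef
  set β := (n : ℝ)⁻¹ * ∑ k, |f (φ k t)| with hβdef
  have heq : g t - α * β = (g t - α) + α * (1 - β) := by ring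
  rw [heq, Real.norm_eq_abs]
  refine (abs_add_le _ _).trans ?_
  rw [abs_mul]
  have h7 : |α| * |1 - β| ≤ 1 * (ε / 2 + 1 / n) :=
    mul_le_mul hα1 hβ (abs_nonneg _) zero_le_one
  have h8 : |g t - α| ≤ 2 / n := hα
  have h9 : 3 / (n : ℝ) = 2 / n + 1 / n := by ring
  linarith

end EssentiallyBounded

/-! ### Conclusion -/

theorem tendsto_inv_ultrafilter_pnat {U : Ultrafilter ℕ+} (hU : ∀ i : ℕ+, U ≠ pure i) :
    Tendsto (fun i : ℕ+ => ((i : ℕ) : ℝ)⁻¹) U (𝓝 0) := by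
  have hcof : (U : Filter ℕ+) ≤ cofinite := by
    rcases U.le_cofinite_or_eq_pure with h | ⟨i, hi⟩
    · exact h
    · exact absurd hi (hU i)
  have h1 : Tendsto (fun i : ℕ+ => (i : ℕ)) cofinite atTop := by
    rw [← Nat.cofinite_eq_atTop]
    exact PNat.coe_injective.tendsto_cofinite
  exact (tendsto_inv_atTop_zero.comp (tendsto_natCast_atTop_atTop.comp h1)).mono_left hcof

theorem mainTheorem7 (U : Ultrafilter ℕ+) (hU : ∀ i : ℕ+, U ≠ pure i)
    {X : Type*} [NormedAddCommGroup X] [NormedSpace ℝ X] [CompleteSpace X] :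
    (IsAlmostTransitiveSpace X → IsTransitiveSpace (CabelloM X U)) ∧
    (IsUniformlyConvexTransitive X →
      IsUniformlyConvexTransitive (CabelloM X U) ∧
      IsUniformlyConvexTransitive (BanachUltrapower X U)) ∧
    IsUniformlyConvexTransitive (BanachUltrapower (BochnerUnit ℝ ∞) U) := by
  refine ⟨fun h => ?_, fun h => ⟨?_, ?_⟩, ?_⟩
  · refine isTransitiveSpace_ultraproduct (tendsto_inv_ultrafilter_pnat hU) fun i => ?_
    have hi : (0 : ℝ) < ((i : ℕ) : ℝ)⁻¹ := inv_pos.2 (by exact_mod_cast i.2)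
    -- At exponent `i` the allowed error is `1 / i`, which vanishes along the non-principal `U`;
    -- half is spent in `X`, half on passing to `L^i`.
    exact (h.rotationAverageApprox (half_pos hi)).lp (ENNReal.natCast_ne_top _) (half_pos hi).le
      (half_lt_self hi)
  · refine isUniformlyConvexTransitive_ultraproduct fun ε hε => ?_
    -- The number of terms comes from `X` alone and is thus the same for every exponent.
    obtain ⟨n, hn, H⟩ := h.rotationAverageApprox (half_pos hε)
    have : Nonempty (Fin n) := ⟨⟨0, hn⟩⟩
    exact ⟨n, hn, fun i => H.lp (ENNReal.natCast_ne_top _) (half_pos hε).le (half_lt_self hε)⟩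
  · refine isUniformlyConvexTransitive_ultraproduct fun ε hε => ?_
    obtain ⟨n, hn, H⟩ := h.rotationAverageApprox hε
    exact ⟨n, hn, fun _ => H⟩
  · refine isUniformlyConvexTransitive_ultraproduct fun ε hε => ?_
    obtain ⟨n, hn, H⟩ := rotationAverageApprox_Linfty hε
    exact ⟨n, hn, fun _ => H⟩
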